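/- For $a,b\in\mathbb{R}$ let $w_{a,b}:\mathbb{R}^2\to\mathbb{C}$, $w_{a,b}(q,p)=e^{i(aq+bp)}$. Let $B(\mathbb{R}^2)$ be the algebra of bounded universally measurable functions $\mathbb{R}^2\to\mathbb{C}$ (measurable with respect to the completion of every finite Borel measure), with pointwise operations, complex conjugation and the supremum norm, and let $AP(\mathbb{R}^2)$ be the smallest C*-algebra of bounded functions on $\mathbb{R}^2$ that contains all $w_{a,b}$. The weak* topology on $B(\mathbb{R}^2)$ is the coarsest topology for which $f\mapsto\int f\,d\mu$ is continuous for every finite Borel measure $\mu$ on $\mathbb{R}^2$. For a (not necessarily unital) C*-algebra $\mathfrak{A}$, the bidual $\mathfrak{A}^{**}$ carries the product and involution that extend those of $\mathfrak{A}$, namely $(FG)(f)=F\bigl(a\mapsto G(b\mapsto f(ab))\bigr)$ and $F^*(f)=\overline{F(f^*)}$ with $f^*(a)=\overline{f(a^*)}$ for $F,G\in\mathfrak{A}^{**}$, $f\in\mathfrak{A}^*$, $a,b\in\mathfrak{A}$; its weak* topology is $\sigma(\mathfrak{A}^{**},\mathfrak{A}^*)$. A w*-representation of $\mathfrak{A}^{**}$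 is a *-homomorphism into the bounded operators $\mathcal{B}(\mathscr{H})$ of a Hilbert space $\mathscr{H}$ that is continuous from the weak* topology to the weak operator topology. Let $\mathfrak{C}$ be a C*-algebra (with the supremum norm) such that $AP(\mathbb{R}^2)\subseteq\mathfrak{C}\subseteq B(\mathbb{R}^2)$, and let $\mathcal{Q}:\mathfrak{C}\to\mathfrak{A}^{**}$ be a linear, *-preserving map into the bidual of a C*-algebra $\mathfrak{A}$ that is weakly continuous, that is, continuous from the subspace topology on $\mathfrak{C}$ induced by the weak* topology of $B(\mathbb{R}^2)$ to the weak* topology of $\mathfrak{A}^{**}$. Then every representation (*-homomorphism) $\pi:\mathfrak{A}\to\mathcal{B}(\mathscr{H})$ on a Hilbert space $\mathscr{H}$ has a unique extension to a w*-representation $\tilde\pi:\mathfrak{A}^{**}\to\mathcal{B}(\mathscr{H})$, and $\tilde\pi$ is regular: for all $\varphi,\psi\in\mathscr{H}$ the maps $$a\mapsto\langle\varphi,\tilde\pi(\mathcal{Q}(w_{a,0}))\psi\rangle\qquad\text{and}\qquad b\mapsto\langle\varphi,\tilde\pi(\mathcal{Q}(w_{0,b}))\psi\rangle$$ are continuous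 on $\mathbb{R}$. -/

import Mathlib

open MeasureTheory
open scoped ENNReal Topology ComplexConjugate InnerProductSpace

noncomputable section

namespace Quantization

/-! ### Classical quantities on the phase space `ℝ × ℝ` -/

/-- The C*-algebra of all bounded functions `ℝ² → ℂ`, with pointwise operations, complex
conjugation and the supremum norm. -/
abbrev BoundedFun : Type := lp (fun _ : ℝ × ℝ => ℂ) ∞

/-- A function `ℝ² → ℂ` is universally measurable if preimages of Borel sets are measurable
with respect to the completion of every finite Borel measure on `ℝ²`. -/
def IsUnivMeasurable (f : ℝ × ℝ → ℂ) : Prop :=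
  ∀ μ : Measure (ℝ × ℝ), IsFiniteMeasure μ → NullMeasurable f μ

theorem isUnivMeasurable_iff {f : ℝ × ℝ → ℂ} :
    IsUnivMeasurable f ↔ ∀ μ : Measure (ℝ × ℝ), IsFiniteMeasure μ → AEMeasurable f μ :=
  ⟨fun h μ hμ => (h μ hμ).aemeasurable, fun h μ hμ => (h μ hμ).nullMeasurable⟩

/-- `B(ℝ²)`: the *-algebra of bounded universally measurable functions. -/
def BMeas : StarSubalgebra ℂ BoundedFun where
  carrier := {f | IsUnivMeasurable f}
  mul_mem' {f g} hf hg := by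
    rw [Set.mem_ofPred_eq, isUnivMeasurable_iff] at *
    intro μ hμ
    exact (hf μ hμ).mul (hg μ hμ)
  add_mem' {f g} hf hg := by
    rw [Set.mem_ofPred_eq, isUnivMeasurable_iff] at *
    intro μ hμ
    exact (hf μ hμ).add (hg μ hμ)
  algebraMap_mem' c := by
    rw [Set.mem_ofPred_eq, isUnivMeasurable_iff]
    intro μ _
    exact aemeasurable_const (b := c)
  star_mem' {f} hf := by
    rw [Set.mem_ofPred_eq, isUnivMeasurable_iff] at *
    intro μ hμ
    exact Complex.continuous_conj.measurable.comp_aemeasurable (hf μ hμ)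

/-- The weak* topology of `B(ℝ²)`: the coarsest topology for which all the maps `f ↦ ∫ f dμ`
are continuous, where `μ` runs over the finite Borel measures on `ℝ²` (these span the space of
complex Borel measures). -/
@[reducible] def weakStarBMeas : TopologicalSpace BMeas :=
  TopologicalSpace.induced
    (fun (f : BMeas) (μ : FiniteMeasure (ℝ × ℝ)) => ∫ x, (f : BoundedFun) x ∂(μ : Measure (ℝ × ℝ)))
    inferInstance

/-- The classical Weyl unitary `w_{a,b}(q,p) = e^{i(aq + bp)}`. -/
def weylFun (a b : ℝ) : BoundedFun :=
  ⟨fun x : ℝ × ℝ => Complex.exp (Complex.I * ((a * x.1 + b * x.2 : ℝ) : ℂ)),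
    memℓp_infty ⟨1, by
      rintro _ ⟨x, rfl⟩
      exact (Complex.norm_exp_I_mul_ofReal _).le⟩⟩

/-- `AP(ℝ²)`: the smallest C*-algebra containing all the functions `w_{a,b}`. -/
def AP : StarSubalgebra ℂ BoundedFun :=
  (StarAlgebra.adjoin ℂ {f | ∃ a b : ℝ, f = weylFun a b}).topologicalClosure

theorem weylFun_mem_AP (a b : ℝ) : weylFun a b ∈ AP :=
  StarSubalgebra.le_topologicalClosure _ (StarAlgebra.subset_adjoin ℂ _ ⟨a, b, rfl⟩)

/-! ### The bidual of a C*-algebra -/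

section Bidual

variable (A : Type*) [NonUnitalCStarAlgebra A]

/-- The bidual `A**`. -/
abbrev Bidual : Type _ := StrongDual ℂ (StrongDual ℂ A)

variable {A}

/-- The functional `a ↦ G (b ↦ f (a * b))` on `A`. -/
def dualAct (G : Bidual A) : StrongDual ℂ A →L[ℂ] StrongDual ℂ A :=
  (ContinuousLinearMap.compL ℂ A (StrongDual ℂ A) ℂ G) ∘L
    ((ContinuousLinearMap.compL ℂ A (A →L[ℂ] A) (StrongDual ℂ A)).flip
      (ContinuousLinearMap.mul ℂ A)) ∘L
    (ContinuousLinearMap.compL ℂ A A ℂ)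

theorem dualAct_apply (G : Bidual A) (f : StrongDual ℂ A) (a : A) :
    dualAct G f a = G (f.comp (ContinuousLinearMap.mul ℂ A a)) := rfl

/-- The (Arens) product of the bidual: `(F G)(f) = F (a ↦ G (b ↦ f (a * b)))`. It is the
separately weak* continuous product that extends the product of `A`. -/
def bidualMul (F G : Bidual A) : Bidual A := F.comp (dualAct G)

theorem bidualMul_apply (F G : Bidual A) (f : StrongDual ℂ A) :
    bidualMul F G f = F (dualAct G f) := rfl

/-- The involution of the dual: `f*(a) = conj (f (a*))`. -/
def dualStar (f : StrongDual ℂ A) : StrongDual ℂ A :=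
  ((starL ℂ : ℂ ≃L⋆[ℂ] ℂ) : ℂ →L⋆[ℂ] ℂ).comp (f.comp ((starL ℂ : A ≃L⋆[ℂ] A) : A →L⋆[ℂ] A))

theorem dualStar_apply (f : StrongDual ℂ A) (a : A) : dualStar f a = conj (f (star a)) := rfl

theorem norm_dualStar_le (f : StrongDual ℂ A) : ‖dualStar f‖ ≤ ‖f‖ :=
  ContinuousLinearMap.opNorm_le_bound _ (norm_nonneg _) fun a => by
    rw [dualStar_apply, RCLike.norm_conj]
    exact (f.le_opNorm _).trans_eq (by rw [norm_star])

/-- The involution of the bidual: `F*(f) = conj (F (f*))`. It is the weak* continuous extension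
of the involution of `A`. -/
def bidualStar (F : Bidual A) : Bidual A :=
  LinearMap.mkContinuous
    { toFun := fun f => conj (F (dualStar f))
      map_add' := fun f g => by
        have h : dualStar (f + g) = dualStar f + dualStar g := by
          ext a; simp [dualStar_apply]
        rw [h, map_add, map_add]
      map_smul' := fun c f => by
        have h : dualStar (c • f) = conj c • dualStar f := by
          ext a; simp [dualStar_apply]
        rw [h, map_smul]
        simp }
    ‖F‖ fun f => by
      rw [LinearMap.coe_mk, AddHom.coe_mk, RCLike.norm_conj]
      exact (F.le_opNorm _).trans
        (mul_le_mul_of_nonneg_left (norm_dualStar_le f) (norm_nonneg _))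

theorem bidualStar_apply (F : Bidual A) (f : StrongDual ℂ A) :
    bidualStar F f = conj (F (dualStar f)) := rfl

theorem bidualMul_inclusion (a b : A) :
    bidualMul (NormedSpace.inclusionInDoubleDual ℂ A a)
      (NormedSpace.inclusionInDoubleDual ℂ A b)
      = NormedSpace.inclusionInDoubleDual ℂ A (a * b) := rfl

theorem bidualStar_inclusion (a : A) :
    bidualStar (NormedSpace.inclusionInDoubleDual ℂ A a)
      = NormedSpace.inclusionInDoubleDual ℂ A (star a) := by
  ext f
  simp [bidualStar_apply, dualStar_apply]

variable {H : Type*} [NormedAddCommGroup H] [InnerProductSpace ℂ H] [CompleteSpace H]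

/-- `ρ` is a w*-representation of `A**` on `H`: a *-homomorphism into `𝓑(H)` that is continuous
from the weak* topology `σ(A**, A*)` (carried by the type synonym `WeakDual`) to the weak operator
topology (carried by the type synonym `H →WOT[ℂ] H`). -/
structure IsWStarRep (ρ : Bidual A →ₗ[ℂ] (H →L[ℂ] H)) : Prop where
  map_mul : ∀ F G : Bidual A, ρ (bidualMul F G) = ρ F * ρ G
  map_star : ∀ F : Bidual A, ρ (bidualStar F) = star (ρ F)
  continuous : Continuous fun F : WeakDual ℂ (StrongDual ℂ A) =>
    (ContinuousLinearMapWOT.ofCLM (ρ (WeakDual.toStrongDual F)) : H →WOT[ℂ] H)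

/-- `ρ` is a w*-representation of `A**` that extends the representation `π` of `A`. -/
structure IsWStarExtension (π : A →⋆ₙₐ[ℂ] (H →L[ℂ] H)) (ρ : Bidual A →ₗ[ℂ] (H →L[ℂ] H)) :
    Prop extends IsWStarRep ρ where
  map_inclusion : ∀ a : A, ρ (NormedSpace.inclusionInDoubleDual ℂ A a) = π a

/-! ### Quantization maps and regularity -/

variable {C : StarSubalgebra ℂ BoundedFun}

/-- Weak continuity of a quantization map `Q : C → A**` with `C ⊆ B(ℝ²)`: continuity from the
subspace topology that the weak* topology of `B(ℝ²)` induces on `C` to the weak* topology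
`σ(A**, A*)`. -/
def IsWeaklyContinuous (hB : C ≤ BMeas) (Q : C →ₗ[ℂ] Bidual A) : Prop :=
  Continuous[TopologicalSpace.induced (StarSubalgebra.inclusion hB) weakStarBMeas, inferInstance]
    fun f : C => (StrongDual.toWeakDual (Q f) : WeakDual ℂ (StrongDual ℂ A))

/-- Regularity, relative to `Q`, of a representation `ρ` of `A**`. -/
def IsRegular (hAP : AP ≤ C) (Q : C →ₗ[ℂ] Bidual A) (ρ : Bidual A →ₗ[ℂ] (H →L[ℂ] H)) : Prop :=
  ∀ φ ψ : H,
    Continuous (fun a : ℝ => ⟪φ, ρ (Q ⟨weylFun a 0, hAP (weylFun_mem_AP a 0)⟩) ψ⟫_ℂ) ∧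
    Continuous (fun b : ℝ => ⟪φ, ρ (Q ⟨weylFun 0 b, hAP (weylFun_mem_AP 0 b)⟩) ψ⟫_ℂ)

end Bidual

end Quantization

end

/-!
Everything rests on the matrix coefficients `f_{φ,ψ} = (a ↦ ⟪φ, π a ψ⟫)` of the representation.
A *-homomorphism between C*-algebras is contractive, so `f_{φ,ψ}` lies in `A*` and
`F f_{φ,ψ}` is a bounded sesquilinear form in `(φ, ψ)` for each `F ∈ A**`. The operator that
represents it is `π̃ F` (`bidualExtension`). In other words

  `⟪φ, π̃ F ψ⟫ = F f_{φ,ψ}`,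

from which weak* continuity, the extension property and compatibility with the involution are read
off. Multiplicativity needs no Arens regularity: since `π` is a *-homomorphism,
`b ↦ f_{φ,ψ} (a * b)` is the coefficient `f_{π(a)* φ, ψ}`, so the functional `a ↦ G (b ↦ …)` in the
definition of the product is `f_{φ, π̃ G ψ}` (`dualAct_matrixCoeff`).

Uniqueness: a weak* continuous functional on a dual space is evaluation at an element of the
predual, here an element of `A*`, which is determined by its values on `A`
(`exists_eq_eval_of_weakStar_continuous`).

Regularity: dominated convergence makes `a ↦ ∫ w_{a,b} dμ` and `b ↦ ∫ w_{a,b} dμ` continuous for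
every finite `μ`, i.e. the Weyl functions depend weak* continuously on `(a, b)`; composing with the
weakly continuous `Q` and the weak* continuous `π̃` gives the claim.
-/

noncomputable section

namespace Quantization

section Extension

variable {A : Type*} [NonUnitalCStarAlgebra A]
variable {H : Type*} [NormedAddCommGroup H] [InnerProductSpace ℂ H] [CompleteSpace H]

/-- The matrix coefficient `a ↦ ⟪φ, π a ψ⟫` of a representation, as an element of `A*`. -/
def matrixCoeff (π : A →⋆ₙₐ[ℂ] (H →L[ℂ] H)) (φ ψ : H) : StrongDual ℂ A :=
  LinearMap.mkContinuous
    { toFun := fun a => ⟪φ, π a ψ⟫_ℂ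
      map_add' := fun a b => by simp
      map_smul' := fun c a => by simp }
    (‖φ‖ * ‖ψ‖) fun a => by
      have h₁ : ‖π a ψ‖ ≤ ‖a‖ * ‖ψ‖ :=
        (π a).le_of_opNorm_le (NonUnitalStarAlgHom.norm_apply_le π a) ψ
      calc ‖⟪φ, π a ψ⟫_ℂ‖ ≤ ‖φ‖ * ‖π a ψ‖ := norm_inner_le_norm _ _
        _ ≤ ‖φ‖ * (‖a‖ * ‖ψ‖) := by gcongr
        _ = ‖φ‖ * ‖ψ‖ * ‖a‖ := by ring

theorem matrixCoeff_apply (π : A →⋆ₙₐ[ℂ] (H →L[ℂ] H)) (φ ψ : H) (a : A) :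
    matrixCoeff π φ ψ a = ⟪φ, π a ψ⟫_ℂ := rfl

theorem norm_matrixCoeff_le (π : A →⋆ₙₐ[ℂ] (H →L[ℂ] H)) (φ ψ : H) :
    ‖matrixCoeff π φ ψ‖ ≤ ‖φ‖ * ‖ψ‖ :=
  LinearMap.mkContinuous_norm_le _ (by positivity) _

/-- For `F ∈ A**`, the bounded sesquilinear form `(φ, ψ) ↦ F (a ↦ ⟪φ, π a ψ⟫)`. -/
def bidualForm (π : A →⋆ₙₐ[ℂ] (H →L[ℂ] H)) (F : Bidual A) : H →L⋆[ℂ] H →L[ℂ] ℂ :=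
  LinearMap.mkContinuous₂
    (LinearMap.mk₂'ₛₗ (starRingEnd ℂ) (RingHom.id ℂ) (fun φ ψ => F (matrixCoeff π φ ψ))
      (fun φ φ' ψ => by
        rw [← map_add]
        congr 1
        ext a
        simp [matrixCoeff_apply])
      (fun c φ ψ => by
        rw [← map_smul]
        congr 1
        ext a
        simp [matrixCoeff_apply, mul_comm])
      (fun φ ψ ψ' => by
        rw [← map_add]
        congr 1
        ext a
        simp [matrixCoeff_apply])
      (fun c φ ψ => by
        rw [RingHom.id_apply, ← map_smul]
        congr 1
        ext a
        simp [matrixCoeff_apply]))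
    ‖F‖ fun φ ψ => by
      rw [LinearMap.mk₂'ₛₗ_apply, mul_assoc]
      exact F.le_of_opNorm_le_of_le le_rfl (norm_matrixCoeff_le π φ ψ)

theorem bidualForm_apply (π : A →⋆ₙₐ[ℂ] (H →L[ℂ] H)) (F : Bidual A) (φ ψ : H) :
    bidualForm π F φ ψ = F (matrixCoeff π φ ψ) := rfl

/-- The operator `T` with `⟪φ, T ψ⟫ = F (a ↦ ⟪φ, π a ψ⟫)`. The adjoint appears because
`continuousLinearMapOfBilin` represents the form in the first argument of the inner product. -/
def bidualOperator (π : A →⋆ₙₐ[ℂ] (H →L[ℂ] H)) (F : Bidual A) : H →L[ℂ] H :=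
  ContinuousLinearMap.adjoint (InnerProductSpace.continuousLinearMapOfBilin (bidualForm π F))

theorem inner_bidualOperator (π : A →⋆ₙₐ[ℂ] (H →L[ℂ] H)) (F : Bidual A) (φ ψ : H) :
    ⟪φ, bidualOperator π F ψ⟫_ℂ = F (matrixCoeff π φ ψ) := by
  rw [bidualOperator, ContinuousLinearMap.adjoint_inner_right,
    InnerProductSpace.continuousLinearMapOfBilin_apply, bidualForm_apply]

/-- The weak* continuous extension of a representation of `A` to the bidual `A**`. -/
def bidualExtension (π : A →⋆ₙₐ[ℂ] (H →L[ℂ] H)) : Bidual A →ₗ[ℂ] (H →L[ℂ] H) where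
  toFun := bidualOperator π
  map_add' F G := by
    ext ψ
    refine ext_inner_left ℂ fun φ => ?_
    simp [inner_add_right, inner_bidualOperator]
  map_smul' c F := by
    ext ψ
    refine ext_inner_left ℂ fun φ => ?_
    simp [inner_smul_right, inner_bidualOperator]

theorem inner_bidualExtension (π : A →⋆ₙₐ[ℂ] (H →L[ℂ] H)) (F : Bidual A) (φ ψ : H) :
    ⟪φ, bidualExtension π F ψ⟫_ℂ = F (matrixCoeff π φ ψ) :=
  inner_bidualOperator π F φ ψ

theorem matrixCoeff_comp_mul (π : A →⋆ₙₐ[ℂ] (H →L[ℂ] H)) (φ ψ : H) (a : A) :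
    (matrixCoeff π φ ψ).comp (ContinuousLinearMap.mul ℂ A a)
      = matrixCoeff π (star (π a) φ) ψ := by
  ext b
  simp [matrixCoeff_apply, ContinuousLinearMap.star_eq_adjoint,
    ContinuousLinearMap.adjoint_inner_left]

theorem dualAct_matrixCoeff (π : A →⋆ₙₐ[ℂ] (H →L[ℂ] H)) (G : Bidual A) (φ ψ : H) :
    dualAct G (matrixCoeff π φ ψ) = matrixCoeff π φ (bidualExtension π G ψ) := by
  ext a
  rw [dualAct_apply, matrixCoeff_comp_mul, ← inner_bidualExtension, matrixCoeff_apply,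
    ContinuousLinearMap.star_eq_adjoint, ContinuousLinearMap.adjoint_inner_left]

theorem dualStar_matrixCoeff (π : A →⋆ₙₐ[ℂ] (H →L[ℂ] H)) (φ ψ : H) :
    dualStar (matrixCoeff π φ ψ) = matrixCoeff π ψ φ := by
  ext a
  rw [dualStar_apply, matrixCoeff_apply, matrixCoeff_apply, map_star, inner_conj_symm,
    ContinuousLinearMap.star_eq_adjoint, ContinuousLinearMap.adjoint_inner_left]

theorem isWStarExtension_bidualExtension (π : A →⋆ₙₐ[ℂ] (H →L[ℂ] H)) :
    IsWStarExtension π (bidualExtension π) where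
  map_mul F G := by
    ext ψ
    refine ext_inner_left ℂ fun φ => ?_
    rw [inner_bidualExtension, bidualMul_apply, dualAct_matrixCoeff, ← inner_bidualExtension]
    rfl
  map_star F := by
    ext ψ
    refine ext_inner_left ℂ fun φ => ?_
    rw [inner_bidualExtension, bidualStar_apply, dualStar_matrixCoeff, ← inner_bidualExtension,
      inner_conj_symm, ContinuousLinearMap.star_eq_adjoint,
      ContinuousLinearMap.adjoint_inner_right]
  continuous := by
    refine ContinuousLinearMapWOT.continuous_of_dual_apply_continuous fun ψ y => ?_
    -- By the Riesz representation theorem, `y` is the inner product with a vector `φ`.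
    obtain ⟨φ, rfl⟩ := (InnerProductSpace.toDual ℂ H).surjective y
    have h : ∀ F : WeakDual ℂ (StrongDual ℂ A),
        InnerProductSpace.toDual ℂ H φ (ContinuousLinearMapWOT.ofCLM
          (bidualExtension π (WeakDual.toStrongDual F)) ψ) = F (matrixCoeff π φ ψ) :=
      fun F => inner_bidualExtension π _ φ ψ
    simp_rw [h]
    exact WeakDual.eval_continuous _
  map_inclusion a := by
    ext ψ
    refine ext_inner_left ℂ fun φ => ?_
    rw [inner_bidualExtension, NormedSpace.dual_def, matrixCoeff_apply]

theorem IsWStarRep.continuous_inner {ρ : Bidual A →ₗ[ℂ] (H →L[ℂ] H)} (hρ : IsWStarRep ρ)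
    (φ ψ : H) :
    Continuous fun F : WeakDual ℂ (StrongDual ℂ A) => ⟪φ, ρ (WeakDual.toStrongDual F) ψ⟫_ℂ :=
  (ContinuousLinearMapWOT.continuous_dual_apply ψ (InnerProductSpace.toDual ℂ H φ)).comp
    hρ.continuous

/-- A weak* continuous functional on the dual of a normed space is evaluation at a vector. -/
theorem exists_eq_eval_of_weakStar_continuous {V : Type*} [NormedAddCommGroup V]
    [NormedSpace ℂ V] (ℓ : WeakDual ℂ V →L[ℂ] ℂ) : ∃ v : V, ∀ F : WeakDual ℂ V, ℓ F = F v := by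
  -- `WeakDual` is a type synonym of `WeakBilin` for the canonical pairing.
  let ℓ' : StrongDual ℂ (WeakBilin (topDualPairing ℂ V)) :=
    { toFun := ℓ, map_add' := map_add ℓ, map_smul' := map_smul ℓ, cont := ℓ.continuous }
  obtain ⟨v, hv⟩ := LinearMap.dualEmbedding_surjective (topDualPairing ℂ V) ℓ'
  exact ⟨v, fun F => (DFunLike.congr_fun hv F).symm⟩

/-- The uniqueness principle expressing that `A` is weak* dense in `A**`. -/
theorem eq_of_weakStar_continuous {ℓ₁ ℓ₂ : WeakDual ℂ (StrongDual ℂ A) →L[ℂ] ℂ}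
    (h : ∀ a : A, ℓ₁ (StrongDual.toWeakDual (NormedSpace.inclusionInDoubleDual ℂ A a))
      = ℓ₂ (StrongDual.toWeakDual (NormedSpace.inclusionInDoubleDual ℂ A a))) : ℓ₁ = ℓ₂ := by
  obtain ⟨f₁, h₁⟩ := exists_eq_eval_of_weakStar_continuous ℓ₁
  obtain ⟨f₂, h₂⟩ := exists_eq_eval_of_weakStar_continuous ℓ₂
  have hf : f₁ = f₂ := ContinuousLinearMap.ext fun a => by
    simpa only [h₁, h₂] using! h a
  ext F
  rw [h₁, h₂, hf]

theorem IsWStarExtension.unique {π : A →⋆ₙₐ[ℂ] (H →L[ℂ] H)}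
    {ρ σ : Bidual A →ₗ[ℂ] (H →L[ℂ] H)} (hρ : IsWStarExtension π ρ) (hσ : IsWStarExtension π σ) :
    ρ = σ := by
  ext F ψ
  refine ext_inner_left ℂ fun φ => ?_
  let functional (τ : Bidual A →ₗ[ℂ] (H →L[ℂ] H)) (hτ : IsWStarRep τ) :
      WeakDual ℂ (StrongDual ℂ A) →L[ℂ] ℂ :=
    { toFun := fun F => ⟪φ, τ (WeakDual.toStrongDual F) ψ⟫_ℂ
      map_add' := fun F G => by simp
      map_smul' := fun c F => by simp
      cont := hτ.continuous_inner φ ψ }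
  have h : functional ρ hρ.toIsWStarRep = functional σ hσ.toIsWStarRep := by
    refine eq_of_weakStar_continuous fun a => ?_
    change ⟪φ, ρ (NormedSpace.inclusionInDoubleDual ℂ A a) ψ⟫_ℂ
      = ⟪φ, σ (NormedSpace.inclusionInDoubleDual ℂ A a) ψ⟫_ℂ
    rw [hρ.map_inclusion, hσ.map_inclusion]
  exact DFunLike.congr_fun h (StrongDual.toWeakDual F)

end Extension

theorem continuous_integral_weylFun (μ : FiniteMeasure (ℝ × ℝ)) :
    Continuous fun c : ℝ × ℝ => ∫ x, weylFun c.1 c.2 x ∂(μ : Measure (ℝ × ℝ)) := by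
  have h : ∀ c x : ℝ × ℝ,
      weylFun c.1 c.2 x = Complex.exp (Complex.I * ((c.1 * x.1 + c.2 * x.2 : ℝ) : ℂ)) :=
    fun _ _ => rfl
  simp_rw [h]
  refine continuous_of_dominated (bound := fun _ => 1) (fun c => ?_) (fun c => ?_)
    (integrable_const _) ?_
  · exact Continuous.aestronglyMeasurable (by fun_prop)
  · exact Filter.Eventually.of_forall fun x => (Complex.norm_exp_I_mul_ofReal _).le
  · exact Filter.Eventually.of_forall fun x => by fun_prop

section Regularity

variable {A : Type*} [NonUnitalCStarAlgebra A] {C : StarSubalgebra ℂ BoundedFun}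

theorem IsWeaklyContinuous.continuous_weylFun {hB : C ≤ BMeas} {Q : C →ₗ[ℂ] Bidual A}
    (hQ : IsWeaklyContinuous hB Q) (hAP : AP ≤ C) :
    Continuous fun c : ℝ × ℝ =>
      (StrongDual.toWeakDual (Q ⟨weylFun c.1 c.2, hAP (weylFun_mem_AP c.1 c.2)⟩) :
        WeakDual ℂ (StrongDual ℂ A)) := by
  let t : TopologicalSpace C :=
    TopologicalSpace.induced (StarSubalgebra.inclusion hB) weakStarBMeas
  have hw : Continuous fun c : ℝ × ℝ =>
      (⟨weylFun c.1 c.2, hAP (weylFun_mem_AP c.1 c.2)⟩ : C) :=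
    continuous_induced_rng.2 (continuous_induced_rng.2
      (continuous_pi fun μ => continuous_integral_weylFun μ))
  exact Continuous.comp (g := fun f : C => StrongDual.toWeakDual (Q f)) hQ hw

variable {H : Type*} [NormedAddCommGroup H] [InnerProductSpace ℂ H] [CompleteSpace H]

theorem IsWStarRep.isRegular {ρ : Bidual A →ₗ[ℂ] (H →L[ℂ] H)} (hρ : IsWStarRep ρ)
    {hB : C ≤ BMeas} {Q : C →ₗ[ℂ] Bidual A} (hQ : IsWeaklyContinuous hB Q) (hAP : AP ≤ C) :
    IsRegular hAP Q ρ := fun φ ψ =>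
  have h := (hρ.continuous_inner φ ψ).comp (hQ.continuous_weylFun hAP)
  ⟨h.comp (Continuous.prodMk_left (0 : ℝ)), h.comp (Continuous.prodMk_right (0 : ℝ))⟩

end Regularity

end Quantization

end

theorem corollary3 {A : Type*} [NonUnitalCStarAlgebra A]
    (C : StarSubalgebra ℂ Quantization.BoundedFun)
    (_hC : IsClosed (C : Set Quantization.BoundedFun))
    (hAP : Quantization.AP ≤ C) (hB : C ≤ Quantization.BMeas)
    (Q : C →ₗ[ℂ] Quantization.Bidual A)
    (_hQstar : ∀ f : C, Q (star f) = Quantization.bidualStar (Q f))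
    (_hQcont : Quantization.IsWeaklyContinuous hB Q)
    {H : Type*} [NormedAddCommGroup H] [InnerProductSpace ℂ H] [CompleteSpace H]
    (π : A →⋆ₙₐ[ℂ] (H →L[ℂ] H)) :
    (∃! ρ : Quantization.Bidual A →ₗ[ℂ] (H →L[ℂ] H), Quantization.IsWStarExtension π ρ) ∧
      ∀ ρ : Quantization.Bidual A →ₗ[ℂ] (H →L[ℂ] H),
        Quantization.IsWStarExtension π ρ → Quantization.IsRegular hAP Q ρ :=
  ⟨⟨Quantization.bidualExtension π, Quantization.isWStarExtension_bidualExtension π,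
      fun _ hρ => hρ.unique (Quantization.isWStarExtension_bidualExtension π)⟩,
    fun _ hρ => hρ.toIsWStarRep.isRegular _hQcont hAP⟩
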